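/- For $\nu>-1$ let $J_\nu(z)=\sum_{n\ge0}\frac{(-1)^n}{n!\,\Gamma(n+\nu+1)}\left(\frac z2\right)^{2n+\nu}$ be the Bessel function of the first kind and let $g_\nu(z)=2^\nu\Gamma(\nu+1)z^{1-\nu}J_\nu(z)$ (principal branches), which is an entire function with $g_\nu(0)=0$, $g_\nu'(0)=1$. For an analytic function $f$ with $f(0)=f'(0)-1=0$, $\alpha\ge0$ and $\beta\in[0,1)$, the radius of $\alpha$-convexity of order $\beta$ of $f$ is $$r_{\alpha,\beta}(f)=\sup\left\{r>0:\ \operatorname{Re}\left((1-\alpha)\frac{zf'(z)}{f(z)}+\alpha\left(1+\frac{zf''(z)}{f'(z)}\right)\right)>\beta\ \text{ for all } |z|<r\right\},$$ where $f$ is analytic and the quotients are defined on $|z|<r$, and $zf'(z)/f(z)$ is given its limit value $1$ at $z=0$. The radii of starlikeness $r^*_\beta(f)$ and of convexity $r^c_\beta(f)$ of order $\beta$ are the corresponding suprema for the conditions $\operatorname{Re}\frac{zf'(z)}{f(z)}>\beta$ and $\operatorname{Re}\left(1+\frac{zf''(z)}{f'(z)}\right)>\beta$, respectively. **Theorem 2.**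 Let $\nu>-1$. For all $\alpha\ge0$ and $\beta\in[0,1)$, the radius $r_{\alpha,\beta}(g_\nu)$ is the smallest positive root $r$ of the equation $$1+(\alpha-1)\frac{rJ_{\nu+1}(r)}{J_\nu(r)}+\alpha r\,\frac{rJ_{\nu+2}(r)-3J_{\nu+1}(r)}{J_\nu(r)-rJ_{\nu+1}(r)}=\beta$$ (a quotient whose coefficient $\alpha-1$ or $\alpha$ vanishes is omitted). Moreover $r_{\alpha,\beta}(g_\nu)\le\alpha_{\nu,1}<j_{\nu,1}$, where $\alpha_{\nu,1}$ and $j_{\nu,1}$ are the first positive zeros, which exist, of the Dini function $z\mapsto(1-\nu)J_\nu(z)+zJ_\nu'(z)$ and of $J_\nu$, respectively. For every $\beta\in[0,1)$ the function $\alpha\mapsto r_{\alpha,\beta}(g_\nu)$ is strictly decreasing on $[0,\infty)$, and consequently $r^c_\beta(g_\nu)<r_{\alpha,\beta}(g_\nu)<r^*_\beta(g_\nu)$ for all $\alpha\in(0,1)$ and $\beta\in[0,1)$. -/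

import Mathlib

open Set

noncomputable section

/-- The Bessel function of the first kind of order `ν`,
`J_ν(z) = ∑ (-1)^n / (n! Γ(n + ν + 1)) (z / 2)^(2n + ν)`, with the principal branch of the power.
At the poles of `Γ` Mathlib's `Gamma` is `0`, so that `1 / Γ` is `0` there, as it should be. -/
def besselJ (ν z : ℂ) : ℂ :=
  ∑' n : ℕ, (-1) ^ n / ((n.factorial : ℂ) * Complex.Gamma (n + ν + 1)) *
    (z / 2) ^ (2 * (n : ℂ) + ν)

/-- The normalized Bessel function `g_ν(z) = 2^ν Γ(ν + 1) z^(1 - ν) J_ν(z)`. With the principal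
branches the powers combine to `z^(1 - ν) (z / 2)^(2n + ν) = 2^(-ν) z (z / 2)^(2n)` for `z ≠ 0`, and
the value at `z = 0` is `0`, so this is the entire function `z - z^3 / (4 (ν + 1)) + ⋯`. -/
def besselG (ν : ℝ) (z : ℂ) : ℂ :=
  (2 : ℂ) ^ (ν : ℂ) * Complex.Gamma (ν + 1) * z ^ (1 - (ν : ℂ)) * besselJ ν z

/-- The Dini function `z ↦ (1 - ν) J_ν(z) + z J_ν'(z)`. -/
def besselDini (ν : ℝ) (z : ℂ) : ℂ :=
  (1 - (ν : ℂ)) * besselJ ν z + z * deriv (besselJ ν) z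

/-- `z f'(z) / f(z)`, for `f` with `f(0) = 0`, `f'(0) = 1`; at the removable singularity `z = 0`
it has the value `1`. -/
def starlikeQuot (f : ℂ → ℂ) (z : ℂ) : ℂ :=
  if z = 0 then 1 else z * deriv f z / f z

/-- `1 + z f''(z) / f'(z)`. -/
def convexQuot (f : ℂ → ℂ) (z : ℂ) : ℂ :=
  1 + z * deriv (deriv f) z / deriv f z

/-- The radius of starlikeness of order `β` of a normalized analytic function `f`: the supremum of
all `r > 0` such that `Re (z f'(z) / f(z)) > β` on the disk `|z| < r`. That `f` is analytic on the
disk and that the quotient is defined there (away from the removable singularity at `0`) is spelled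
out. -/
def radiusStarlike (β : ℝ) (f : ℂ → ℂ) : ℝ :=
  sSup {r : ℝ | 0 < r ∧ DifferentiableOn ℂ f (Metric.ball 0 r) ∧
    ∀ z ∈ Metric.ball (0 : ℂ) r, (z ≠ 0 → f z ≠ 0) ∧ β < (starlikeQuot f z).re}

/-- The radius of convexity of order `β` of a normalized analytic function `f`: the supremum of
all `r > 0` such that `Re (1 + z f''(z) / f'(z)) > β` on the disk `|z| < r`, where `f` is analytic
and the quotient is defined. -/
def radiusConvex (β : ℝ) (f : ℂ → ℂ) : ℝ :=
  sSup {r : ℝ | 0 < r ∧ DifferentiableOn ℂ f (Metric.ball 0 r) ∧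
    ∀ z ∈ Metric.ball (0 : ℂ) r, deriv f z ≠ 0 ∧ β < (convexQuot f z).re}

/-- The radius of `α`-convexity of order `β` of a normalized analytic function `f`: the supremum of
all `r > 0` such that `Re ((1 - α) z f'(z) / f(z) + α (1 + z f''(z) / f'(z))) > β` on the disk
`|z| < r`, where `f` is analytic and the quotients are defined. -/
def radiusAlphaConvex (α β : ℝ) (f : ℂ → ℂ) : ℝ :=
  sSup {r : ℝ | 0 < r ∧ DifferentiableOn ℂ f (Metric.ball 0 r) ∧
    ∀ z ∈ Metric.ball (0 : ℂ) r, (z ≠ 0 → f z ≠ 0) ∧ deriv f z ≠ 0 ∧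
      β < ((1 - (α : ℂ)) * starlikeQuot f z + (α : ℂ) * convexQuot f z).re}

/-- `r > 0` is a positive root of the equation
`1 + (α - 1) r J_{ν+1}(r) / J_ν(r)
  + α r (r J_{ν+2}(r) - 3 J_{ν+1}(r)) / (J_ν(r) - r J_{ν+1}(r)) = β`,
where each quotient that occurs in it with a nonzero coefficient has a nonzero denominator. -/
def IsPosRootAlphaConvex (ν α β r : ℝ) : Prop :=
  0 < r ∧
  (α ≠ 1 → besselJ ν r ≠ 0) ∧
  (α ≠ 0 → besselJ ν r - r * besselJ (ν + 1) r ≠ 0) ∧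
  1 + ((α : ℂ) - 1) * (r * besselJ (ν + 1) r / besselJ ν r)
    + (α : ℂ) * r * ((r * besselJ (ν + 2) r - 3 * besselJ (ν + 1) r) /
        (besselJ ν r - r * besselJ (ν + 1) r)) = (β : ℂ)

end

noncomputable section

open Filter Topology Metric

/-! Write `besselG ν z = z * φ (z ^ 2)` with `φ = besselPhi ν`, and put `U w = -w φ'(w) / φ(w)`. In
the variable `w = z ^ 2` the starlikeness quotient is `1 - 2 U` and the `α`-convexity quotient is `1
- 2 F`, where `F = U + 2 α w U' / (1 - 2 U)`.

Bessel's equation becomes the Riccati equation `w U' + ν U = w / 4 + U ^ 2` (`besselU_riccati`).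
Comparing coefficients gives a recursion that makes all Taylor coefficients of `U` nonnegative, so
no product expansion and no reality of the zeros is needed. The same recursion bounds the
coefficients below geometrically, hence `U` is not entire and `φ` has a zero; a Pringsheim argument
puts one of least modulus at some `R > 0` (`exists_first_zero_besselPhi`).

Nonnegative coefficients give `‖U w‖ ≤ U ‖w‖` and the same for `w U'`. By Rolle, `U` reaches `1 / 2`
at some `a < R`, where `√a` is the first Dini zero and `√R` the first Bessel zero. On `‖w‖ < a` it
follows that `‖F w‖ ≤ F ‖w‖` (`norm_besselF_le`), and `F` increases on `[0, a)`. The real part of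
the quotient is therefore smallest on the positive axis, and the radius is `√x` for the first `x`
with `F x = (1 - β) / 2`. Since `F` also increases with `α`, the radius decreases. -/

/-! ### Power series on a disk: uniqueness, derivatives, products. -/

theorem hasFPowerSeriesOnBall_of_hasSum {a : ℕ → ℂ} {F : ℂ → ℂ} {r : ℝ} (hr : 0 < r)
    (h : ∀ w ∈ ball (0 : ℂ) r, HasSum (fun n => a n * w ^ n) (F w)) :
    HasFPowerSeriesOnBall F (FormalMultilinearSeries.ofScalars ℂ a) 0 (ENNReal.ofReal r) where
  r_le := by
    refine ENNReal.le_of_forall_nnreal_lt fun s hs => ?_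
    apply FormalMultilinearSeries.le_radius_of_summable
    have hs' : (s : ℝ) < r := by
      rw [← ENNReal.ofReal_coe_nnreal] at hs
      exact (ENNReal.ofReal_lt_ofReal_iff hr).1 hs
    have := (h ((s : ℝ) : ℂ) (by simpa using hs')).summable.norm
    simpa [FormalMultilinearSeries.ofScalars_norm] using this
  r_pos := by simpa using hr
  hasSum := by
    intro y hy
    rw [eball_ofReal] at hy
    simpa [FormalMultilinearSeries.ofScalars_apply_eq, mul_comm] using h y hy

theorem coeff_unique_of_hasSum {a b : ℕ → ℂ} {F : ℂ → ℂ} {r : ℝ} (hr : 0 < r)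
    (ha : ∀ w ∈ ball (0 : ℂ) r, HasSum (fun n => a n * w ^ n) (F w))
    (hb : ∀ w ∈ ball (0 : ℂ) r, HasSum (fun n => b n * w ^ n) (F w)) : a = b := by
  have h := (hasFPowerSeriesOnBall_of_hasSum hr ha).hasFPowerSeriesAt.eq_formalMultilinearSeries
    (hasFPowerSeriesOnBall_of_hasSum hr hb).hasFPowerSeriesAt
  exact FormalMultilinearSeries.ofScalars_series_injective (𝕜 := ℂ) ℂ h

theorem differentiableOn_of_hasSum {a : ℕ → ℂ} {F : ℂ → ℂ} {r : ℝ} (hr : 0 < r)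
    (h : ∀ w ∈ ball (0 : ℂ) r, HasSum (fun n => a n * w ^ n) (F w)) :
    DifferentiableOn ℂ F (ball 0 r) := by
  simpa [eball_ofReal] using (hasFPowerSeriesOnBall_of_hasSum hr h).differentiableOn

/-- The Taylor coefficients at `0`. -/
def taylorCoeff (F : ℂ → ℂ) (n : ℕ) : ℂ := iteratedDeriv n F 0 / n.factorial

theorem hasSum_taylorCoeff {F : ℂ → ℂ} {r : ℝ} (hF : DifferentiableOn ℂ F (ball 0 r))
    {w : ℂ} (hw : w ∈ ball (0 : ℂ) r) : HasSum (fun n => taylorCoeff F n * w ^ n) (F w) := by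
  convert! Complex.hasSum_taylorSeries_on_ball hF hw using 1
  ext n
  rw [taylorCoeff, sub_zero, smul_eq_mul, smul_eq_mul]
  ring

theorem taylorCoeff_deriv (F : ℂ → ℂ) (n : ℕ) :
    taylorCoeff (deriv F) n = (n + 1) * taylorCoeff F (n + 1) := by
  have : (n.factorial : ℂ) ≠ 0 := by exact_mod_cast n.factorial_ne_zero
  have h' : (n + 1 : ℂ) ≠ 0 := by exact_mod_cast n.succ_ne_zero
  simp only [taylorCoeff, iteratedDeriv_succ', Nat.factorial_succ]
  push_cast
  field_simp

theorem hasSum_deriv_of_hasSum {a : ℕ → ℂ} {F : ℂ → ℂ} {r : ℝ} (hr : 0 < r)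
    (h : ∀ w ∈ ball (0 : ℂ) r, HasSum (fun n => a n * w ^ n) (F w)) {w : ℂ}
    (hw : w ∈ ball (0 : ℂ) r) :
    HasSum (fun n : ℕ => ((n + 1) * a (n + 1)) * w ^ n) (deriv F w) := by
  have hF := differentiableOn_of_hasSum hr h
  obtain rfl := coeff_unique_of_hasSum hr h (fun w hw => hasSum_taylorCoeff hF hw)
  simpa only [taylorCoeff_deriv] using hasSum_taylorCoeff (hF.deriv isOpen_ball) hw

theorem hasSum_mul_deriv_of_hasSum {a : ℕ → ℂ} {F : ℂ → ℂ} {r : ℝ} (hr : 0 < r)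
    (h : ∀ w ∈ ball (0 : ℂ) r, HasSum (fun n => a n * w ^ n) (F w)) {w : ℂ}
    (hw : w ∈ ball (0 : ℂ) r) :
    HasSum (fun n : ℕ => (n * a n) * w ^ n) (w * deriv F w) := by
  rw [← hasSum_nat_add_iff' 1]
  convert! (hasSum_deriv_of_hasSum hr h hw).mul_left w using 1
  · ext n
    push_cast
    ring
  · simp

theorem hasSum_mul_of_hasSum {a b : ℕ → ℂ} {w A B : ℂ} (ha : HasSum (fun n => a n * w ^ n) A)
    (hb : HasSum (fun n => b n * w ^ n) B) :
    HasSum (fun n => (∑ p ∈ Finset.HasAntidiagonal.antidiagonal n, a p.1 * b p.2) * w ^ n)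
      (A * B) := by
  have key := tsum_mul_tsum_eq_tsum_sum_antidiagonal_of_summable_norm ha.summable.norm
    hb.summable.norm
  have hs := (summable_norm_sum_mul_antidiagonal_of_summable_norm ha.summable.norm
    hb.summable.norm).of_norm
  rw [ha.tsum_eq, hb.tsum_eq] at key
  rw [key]
  convert! hs.hasSum using 1
  ext n
  rw [Finset.sum_mul]
  refine Finset.sum_congr rfl fun p hp => ?_
  rw [← Finset.HasAntidiagonal.mem_antidiagonal.1 hp, pow_add]; ring

/-! ### The entire function `φ` and its differential equation. -/

/-- The coefficients of the entire function `2^ν Γ(ν + 1) w^(-ν/2) J_ν(√w)`. -/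
def besselCoeff (ν : ℝ) (n : ℕ) : ℂ :=
  (-1) ^ n * Complex.Gamma (ν + 1) / (4 ^ n * n.factorial * Complex.Gamma (n + ν + 1))

/-- The entire function `2^ν Γ(ν + 1) w^(-ν/2) J_ν(√w)`. -/
def besselPhi (ν : ℝ) (w : ℂ) : ℂ := ∑' n, besselCoeff ν n * w ^ n

section
variable {ν : ℝ} (hν : -1 < ν)
include hν

theorem natCast_add_ne_zero (n : ℕ) : (n + ν + 1 : ℂ) ≠ 0 := by
  have : (0 : ℝ) < n + ν + 1 := by have : (0 : ℝ) ≤ n := n.cast_nonneg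
                                   linarith
  exact_mod_cast this.ne'

theorem Gamma_ne_zero_of_natCast_add (n : ℕ) : Complex.Gamma (n + ν + 1) ≠ 0 := by
  refine Complex.Gamma_ne_zero_of_re_pos ?_
  have : (0 : ℝ) ≤ n := n.cast_nonneg
  simp; linarith

theorem Gamma_nu_ne_zero : Complex.Gamma (ν + 1) ≠ 0 := by
  simpa using Gamma_ne_zero_of_natCast_add hν 0

theorem besselCoeff_zero : besselCoeff ν 0 = 1 := by
  simp [besselCoeff, Gamma_nu_ne_zero hν]

theorem besselCoeff_succ (n : ℕ) :
    besselCoeff ν (n + 1) = -besselCoeff ν n / (4 * (n + 1) * (n + ν + 1)) := by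
  have h1 := natCast_add_ne_zero hν n
  have h2 := Gamma_ne_zero_of_natCast_add hν n
  have h3 : (n.factorial : ℂ) ≠ 0 := by exact_mod_cast n.factorial_ne_zero
  have h4 : (n + 1 : ℂ) ≠ 0 := by exact_mod_cast n.succ_ne_zero
  have h5 : Complex.Gamma ((n + 1 : ℕ) + ν + 1) = (n + ν + 1) * Complex.Gamma (n + ν + 1) := by
    rw [← Complex.Gamma_add_one _ h1]; push_cast; ring_nf
  rw [besselCoeff, besselCoeff, h5, Nat.factorial_succ]
  push_cast
  field_simp
  ring

theorem hasSum_besselPhi (w : ℂ) : HasSum (fun n => besselCoeff ν n * w ^ n) (besselPhi ν w) := by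
  refine Summable.hasSum ?_
  -- Ratio test: for `n ≥ N` one has `‖w‖ ≤ n (ν + 1)`, which the denominator `4 (n + 1) (n + ν +
  -- 1)` dominates.
  obtain ⟨N, hN⟩ := exists_nat_gt (‖w‖ / (ν + 1))
  have hpos : 0 < ν + 1 := by linarith
  refine summable_of_ratio_norm_eventually_le (r := 1 / 2) (by norm_num) ?_
  filter_upwards [eventually_ge_atTop N] with n hn
  have hn' : ‖w‖ / (ν + 1) ≤ n := hN.le.trans (by exact_mod_cast hn)
  rw [div_le_iff₀ hpos] at hn'
  have h0 : (0 : ℝ) ≤ n := n.cast_nonneg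
  have h1 : ‖(n + ν + 1 : ℂ)‖ = n + ν + 1 := by
    have : (n + ν + 1 : ℂ) = ((n + ν + 1 : ℝ) : ℂ) := by push_cast; ring
    rw [this, Complex.norm_real, Real.norm_of_nonneg (by linarith)]
  have h2 : ‖(n + 1 : ℂ)‖ = n + 1 := by exact_mod_cast Complex.norm_natCast (n + 1)
  rw [besselCoeff_succ hν, pow_succ, norm_mul, norm_div, norm_neg, norm_mul, norm_mul, norm_mul,
    norm_mul, h1, h2, norm_pow, show ‖(4 : ℂ)‖ = 4 by norm_num]
  have h3 : 0 ≤ ‖besselCoeff ν n‖ * ‖w‖ ^ n := by positivity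
  have h4 : ‖w‖ / (4 * (n + 1) * (n + ν + 1)) ≤ 1 / 2 := by
    rw [div_le_iff₀ (by apply mul_pos <;> linarith)]
    nlinarith
  calc _ = ‖besselCoeff ν n‖ * ‖w‖ ^ n * (‖w‖ / (4 * (n + 1) * (n + ν + 1))) := by ring
    _ ≤ ‖besselCoeff ν n‖ * ‖w‖ ^ n * (1 / 2) := by gcongr
    _ = _ := by ring

theorem differentiable_besselPhi : Differentiable ℂ (besselPhi ν) := fun w =>
  (differentiableOn_of_hasSum (r := ‖w‖ + 1) (by positivity)
    (fun z _ => hasSum_besselPhi hν z)).differentiableAt (isOpen_ball.mem_nhds (by simp))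

theorem hasSum_deriv_besselPhi (w : ℂ) :
    HasSum (fun n : ℕ => ((n + 1) * besselCoeff ν (n + 1)) * w ^ n) (deriv (besselPhi ν) w) :=
  hasSum_deriv_of_hasSum (r := ‖w‖ + 1) (by positivity) (fun z _ => hasSum_besselPhi hν z)
    (by simp)

theorem besselPhi_zero : besselPhi ν 0 = 1 := by
  have := (hasSum_besselPhi hν 0).unique (hasSum_single 0 fun n hn => by simp [hn])
  simpa [besselCoeff_zero hν] using this

theorem differentiable_deriv_besselPhi : Differentiable ℂ (deriv (besselPhi ν)) :=
  fun w => ((differentiable_besselPhi hν).analyticAt w).deriv.differentiableAt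

theorem besselPhi_ode (w : ℂ) :
    w * deriv (deriv (besselPhi ν)) w + (ν + 1) * deriv (besselPhi ν) w + besselPhi ν w / 4 = 0 := by
  have h1 := hasSum_mul_deriv_of_hasSum (r := ‖w‖ + 1) (by positivity)
    (fun z _ => hasSum_deriv_besselPhi hν z) (w := w) (by simp)
  have h2 := (hasSum_deriv_besselPhi hν w).mul_left (ν + 1 : ℂ)
  have h3 := (hasSum_besselPhi hν w).div_const 4
  refine ((h1.add h2).add h3).unique ?_
  convert hasSum_zero using 2 with n
  have h4 : (n + 1 : ℂ) ≠ 0 := by exact_mod_cast n.succ_ne_zero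
  have := natCast_add_ne_zero hν n
  rw [besselCoeff_succ hν]
  field_simp
  ring

/-- Differentiation raises the order by one; this turns `J_{ν+1}` and `J_{ν+2}` into `φ'` and `φ''`.
-/
theorem deriv_besselPhi (w : ℂ) :
    deriv (besselPhi ν) w = -(1 / (4 * (ν + 1))) * besselPhi (ν + 1) w := by
  have hν1 : -1 < ν + 1 := by linarith
  refine (hasSum_deriv_besselPhi hν w).unique ?_
  convert! (hasSum_besselPhi hν1 w).mul_left (-(1 / (4 * (ν + 1)) : ℂ)) using 1
  ext n
  have h0 : (ν + 1 : ℂ) ≠ 0 := by simpa using natCast_add_ne_zero hν 0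
  have h3 : (n.factorial : ℂ) ≠ 0 := by exact_mod_cast n.factorial_ne_zero
  have h4 : (n + 1 : ℂ) ≠ 0 := by exact_mod_cast n.succ_ne_zero
  have h5 := Gamma_ne_zero_of_natCast_add hν1 n
  rw [besselCoeff, besselCoeff, Nat.factorial_succ]
  push_cast at h5 ⊢
  rw [Complex.Gamma_add_one (ν + 1) h0, show (n + 1 + ν + 1 : ℂ) = n + (ν + 1) + 1 by ring]
  field_simp
  ring

end

/-! ### Power series with real, mostly nonnegative, coefficients. -/

section NonnegCoeff

variable {t : ℕ → ℝ} {F : ℂ → ℂ} {R : ℝ} (ht : ∀ n, 0 ≤ t n)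
  (hF : ∀ w ∈ ball (0 : ℂ) R, HasSum (fun n => (t n : ℂ) * w ^ n) (F w))
include hF

theorem hasSum_re_of_hasSum {x : ℝ} (hx : |x| < R) : HasSum (fun n => t n * x ^ n) (F x).re := by
  have h := Complex.hasSum_re (hF x (by simpa using hx))
  convert! h using 1
  ext n
  norm_cast

theorem ofReal_re_of_hasSum {x : ℝ} (hx : |x| < R) : ((F x).re : ℂ) = F x := by
  have h := (hF x (by simpa using hx))
  have h' := Complex.hasSum_ofReal.2 (hasSum_re_of_hasSum hF hx)
  push_cast at h'
  exact h'.unique h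

include ht

/-- Termwise triangle inequality; all later bounds on circles come from here. -/
theorem norm_le_re_of_hasSum {w : ℂ} (hw : ‖w‖ < R) : ‖F w‖ ≤ (F ‖w‖).re := by
  have h := hF w (by simpa using hw)
  have h' := hasSum_re_of_hasSum hF (x := ‖w‖) (by simpa using hw)
  rw [← h.tsum_eq]
  refine tsum_of_norm_bounded h' fun n => ?_
  simp [abs_of_nonneg (ht n)]

theorem strictMonoOn_re_of_hasSum (h1 : 0 < t 1) :
    StrictMonoOn (fun x : ℝ => (F x).re) (Ico 0 R) := by
  intro x hx y hy hxy
  have hx' := hasSum_re_of_hasSum hF (x := x) (by rw [abs_of_nonneg hx.1]; exact hx.2)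
  have hy' := hasSum_re_of_hasSum hF (x := y) (by rw [abs_of_nonneg hy.1]; exact hy.2)
  have hx0 := hx.1
  refine hasSum_lt (i := 1) (fun n => ?_) ?_ hx' hy'
  · have := ht n
    show t n * x ^ n ≤ t n * y ^ n
    gcongr
  · simpa using mul_lt_mul_of_pos_left hxy h1

end NonnegCoeff

/-! ### The Riccati equation and the positivity of the Taylor coefficients of `U`. -/

/-- The function `-w φ'(w) / φ(w)`, for `φ = besselPhi ν`. -/
def besselU (ν : ℝ) (w : ℂ) : ℂ := -(w * deriv (besselPhi ν) w / besselPhi ν w)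

/-- The Taylor coefficients of `besselU`, which are real. -/
def rayleighCoeff (ν : ℝ) (n : ℕ) : ℝ := (taylorCoeff (besselU ν) n).re

theorem taylorCoeff_besselU_zero (ν : ℝ) : taylorCoeff (besselU ν) 0 = 0 := by
  simp [taylorCoeff, besselU]

theorem rayleighCoeff_zero (ν : ℝ) : rayleighCoeff ν 0 = 0 := by
  simp [rayleighCoeff, taylorCoeff_besselU_zero]

section
variable {ν : ℝ} (hν : -1 < ν)
include hν

theorem differentiableAt_besselU {w : ℂ} (hw : besselPhi ν w ≠ 0) :
    DifferentiableAt ℂ (besselU ν) w := by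
  have h1 := differentiable_besselPhi hν w
  have h2 := differentiable_deriv_besselPhi hν w
  unfold besselU
  fun_prop (disch := assumption)

theorem besselU_riccati {w : ℂ} (hw : besselPhi ν w ≠ 0) :
    w * deriv (besselU ν) w + ν * besselU ν w = w / 4 + besselU ν w * besselU ν w := by
  have h1 := (differentiable_besselPhi hν w).hasDerivAt
  have h2 := (differentiable_deriv_besselPhi hν w).hasDerivAt
  have h3 : HasDerivAt (besselU ν) _ w := (((hasDerivAt_id w).mul h2).div h1 hw).neg
  have ode := besselPhi_ode hν w
  rw [h3.deriv]
  simp only [besselU, id, Pi.mul_apply]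
  field_simp
  linear_combination (-4 * w * besselPhi ν w) * ode

theorem exists_besselPhi_ne_zero : ∃ r > 0, ∀ w ∈ ball (0 : ℂ) r, besselPhi ν w ≠ 0 := by
  have h := (differentiable_besselPhi hν).continuous.continuousAt.eventually_ne
    (show besselPhi ν 0 ≠ 0 by simp [besselPhi_zero hν])
  exact Metric.eventually_nhds_iff_ball.1 h

theorem hasSum_besselU_taylorCoeff {r : ℝ} (hr : ∀ w ∈ ball (0 : ℂ) r, besselPhi ν w ≠ 0) {w : ℂ}
    (hw : w ∈ ball (0 : ℂ) r) :
    HasSum (fun n => taylorCoeff (besselU ν) n * w ^ n) (besselU ν w) :=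
  hasSum_taylorCoeff
    (fun z hz => (differentiableAt_besselU hν (hr z hz)).differentiableWithinAt) hw

theorem taylorCoeff_besselU_rec (n : ℕ) :
    (n + ν) * taylorCoeff (besselU ν) n = (if n = 1 then 1 / 4 else 0) +
      ∑ p ∈ Finset.HasAntidiagonal.antidiagonal n,
        taylorCoeff (besselU ν) p.1 * taylorCoeff (besselU ν) p.2 := by
  obtain ⟨r, hr0, hr⟩ := exists_besselPhi_ne_zero hν
  refine congrFun (coeff_unique_of_hasSum hr0
    (a := fun n => (n + ν) * taylorCoeff (besselU ν) n)
    (b := fun n => (if n = 1 then 1 / 4 else 0) + ∑ p ∈ Finset.HasAntidiagonal.antidiagonal n,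
      taylorCoeff (besselU ν) p.1 * taylorCoeff (besselU ν) p.2)
    (F := fun w => w * deriv (besselU ν) w + ν * besselU ν w) (fun w hw => ?_) fun w hw => ?_) n
  · convert! (hasSum_mul_deriv_of_hasSum hr0
      (fun z hz => hasSum_besselU_taylorCoeff hν hr hz) hw).add
      ((hasSum_besselU_taylorCoeff hν hr hw).mul_left (ν : ℂ)) using 1
    ext n
    ring
  · have h1 : HasSum (fun n => (if n = 1 then (1 / 4 : ℂ) else 0) * w ^ n) (w / 4) := by
      convert! hasSum_ite_eq 1 (w / 4) using 1
      ext n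
      split_ifs with h
      · subst h; ring
      · ring
    simp only [besselU_riccati hν (hr w hw)]
    convert! h1.add (hasSum_mul_of_hasSum (hasSum_besselU_taylorCoeff hν hr hw)
      (hasSum_besselU_taylorCoeff hν hr hw)) using 1
    ext n
    ring

theorem taylorCoeff_besselU_im (n : ℕ) : (taylorCoeff (besselU ν) n).im = 0 := by
  induction n using Nat.strong_induction_on with
  | _ n ih =>
  rcases Nat.eq_zero_or_pos n with rfl | hn
  · simp [taylorCoeff_besselU_zero]
  have h := congrArg Complex.im (taylorCoeff_besselU_rec hν n)
  have h2 : (∑ p ∈ Finset.HasAntidiagonal.antidiagonal n,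
      taylorCoeff (besselU ν) p.1 * taylorCoeff (besselU ν) p.2).im = 0 := by
    rw [Complex.im_sum]
    refine Finset.sum_eq_zero fun p hp => ?_
    have hp' := Finset.HasAntidiagonal.mem_antidiagonal.1 hp
    -- The coefficient of index `0` vanishes, so only pairs with both indices below `n` contribute
    -- and the induction applies.
    rcases Nat.eq_zero_or_pos p.1 with h0 | h0
    · simp [h0, taylorCoeff_besselU_zero]
    rcases Nat.eq_zero_or_pos p.2 with h1 | h1
    · simp [h1, taylorCoeff_besselU_zero]
    rw [Complex.mul_im, ih p.1 (by omega), ih p.2 (by omega)]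
    simp
  have h3 : (if n = 1 then (1 / 4 : ℂ) else 0).im = 0 := by split_ifs <;> norm_num
  rw [Complex.add_im, h2, h3, show (n + ν : ℂ) = ((n + ν : ℝ) : ℂ) by push_cast; ring,
    Complex.im_ofReal_mul, add_zero] at h
  have hn1 : (1 : ℝ) ≤ n := by exact_mod_cast hn
  exact (mul_eq_zero.1 h).resolve_left (by linarith)

theorem ofReal_rayleighCoeff (n : ℕ) : (rayleighCoeff ν n : ℂ) = taylorCoeff (besselU ν) n :=
  Complex.ext (by simp [rayleighCoeff]) (by simp [taylorCoeff_besselU_im hν])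

theorem rayleighCoeff_rec (n : ℕ) :
    (n + ν) * rayleighCoeff ν n = (if n = 1 then 1 / 4 else 0) +
      ∑ p ∈ Finset.HasAntidiagonal.antidiagonal n, rayleighCoeff ν p.1 * rayleighCoeff ν p.2 := by
  have h := taylorCoeff_besselU_rec hν n
  simp only [← ofReal_rayleighCoeff hν] at h
  apply Complex.ofReal_injective
  push_cast
  rw [h]
  split_ifs <;> simp

theorem rayleighCoeff_one : rayleighCoeff ν 1 = 1 / (4 * (ν + 1)) := by
  have h := rayleighCoeff_rec hν 1
  have h1 : ν + 1 ≠ 0 := by linarith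
  simp [Finset.Nat.antidiagonal_succ, rayleighCoeff_zero] at h
  rw [eq_div_iff (by simpa using h1)]
  linarith

/-- Ansatz `A ρ ^ n` in the recursion: the convolution contributes `(n - 1) A ^ 2 ρ ^ n`, so `(n -
1) A ≥ n + ν` is needed for `n ≥ 2`. The case `n = 2` forces `A ≥ ν + 2`, and `A = ν + 2` suffices
because `ν > -1`; the value at `n = 1` then fixes `ρ`. -/
theorem rayleighCoeff_ge {n : ℕ} (hn : 1 ≤ n) :
    (ν + 2) * (1 / (4 * (ν + 1) * (ν + 2))) ^ n ≤ rayleighCoeff ν n := by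
  have hν1 : 0 < ν + 1 := by linarith
  have hν2 : 0 < ν + 2 := by linarith
  set ρ := 1 / (4 * (ν + 1) * (ν + 2)) with hρ
  have hρ0 : 0 < ρ := by positivity
  induction n using Nat.strong_induction_on with
  | _ n ih =>
  obtain rfl | ⟨m, rfl⟩ : n = 1 ∨ ∃ m, n = m + 2 := by
    rcases n with _ | _ | m
    · omega
    · simp
    · exact Or.inr ⟨m, rfl⟩
  · rw [rayleighCoeff_one hν, hρ]
    apply le_of_eq
    field_simp
  have h := rayleighCoeff_rec hν (m + 2)
  -- The two end terms of the convolution contain the zero coefficient; `m + 1` terms remain.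
  rw [if_neg (by omega), zero_add, Finset.Nat.sum_antidiagonal_eq_sum_range_succ_mk,
    Finset.sum_range_succ, Finset.sum_range_succ'] at h
  simp only [rayleighCoeff_zero, Nat.sub_self, mul_zero, zero_mul, add_zero] at h
  have h2 : (m + 1) * ((ν + 2) ^ 2 * ρ ^ (m + 2)) ≤ ∑ i ∈ Finset.range (m + 1),
      rayleighCoeff ν (i + 1) * rayleighCoeff ν (m + 2 - (i + 1)) := by
    have := Finset.card_nsmul_le_sum (Finset.range (m + 1)) (fun i =>
      rayleighCoeff ν (i + 1) * rayleighCoeff ν (m + 2 - (i + 1))) ((ν + 2) ^ 2 * ρ ^ (m + 2)) ?_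
    · simpa using this
    intro i hi
    have hi' := Finset.mem_range.1 hi
    have e : ρ ^ (m + 2) = ρ ^ (i + 1) * ρ ^ (m + 2 - (i + 1)) := by
      rw [← pow_add]; congr 1; omega
    calc (ν + 2) ^ 2 * ρ ^ (m + 2)
        = ((ν + 2) * ρ ^ (i + 1)) * ((ν + 2) * ρ ^ (m + 2 - (i + 1))) := by rw [e]; ring
      _ ≤ _ := by
        have h3 := ih (i + 1) (by omega) (by omega)
        exact mul_le_mul h3 (ih (m + 2 - (i + 1)) (by omega) (by omega)) (by positivity)
          (le_trans (by positivity) h3)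
  rw [← h] at h2
  push_cast at h2
  have hm : (0 : ℝ) ≤ m := m.cast_nonneg
  have h4 : (m + 2 + ν) * ((ν + 2) * ρ ^ (m + 2)) ≤ (m + 1) * ((ν + 2) ^ 2 * ρ ^ (m + 2)) := by
    have h5 : 0 ≤ (ν + 2) * ρ ^ (m + 2) := by positivity
    have h6 : m + 2 + ν ≤ (m + 1) * (ν + 2) := by nlinarith
    calc _ ≤ ((m + 1) * (ν + 2)) * ((ν + 2) * ρ ^ (m + 2)) := by gcongr
      _ = _ := by ring
  exact le_of_mul_le_mul_left (h4.trans h2) (by linarith)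

theorem rayleighCoeff_one_pos : 0 < rayleighCoeff ν 1 := by
  rw [rayleighCoeff_one hν]
  have : 0 < ν + 1 := by linarith
  positivity

theorem rayleighCoeff_nonneg (n : ℕ) : 0 ≤ rayleighCoeff ν n := by
  rcases Nat.eq_zero_or_pos n with rfl | hn
  · rw [rayleighCoeff_zero]
  · have hν1 : 0 < ν + 1 := by linarith
    have hν2 : 0 < ν + 2 := by linarith
    exact le_trans (by positivity) (rayleighCoeff_ge hν hn)

theorem hasSum_besselU {r : ℝ} (hr : ∀ w ∈ ball (0 : ℂ) r, besselPhi ν w ≠ 0) :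
    ∀ w ∈ ball (0 : ℂ) r, HasSum (fun n => (rayleighCoeff ν n : ℂ) * w ^ n) (besselU ν w) := by
  intro w hw
  simpa only [ofReal_rayleighCoeff hν] using hasSum_besselU_taylorCoeff hν hr hw

theorem hasSum_mul_deriv_besselU {r : ℝ} (hr0 : 0 < r)
    (hr : ∀ w ∈ ball (0 : ℂ) r, besselPhi ν w ≠ 0) :
    ∀ w ∈ ball (0 : ℂ) r, HasSum (fun n => ((n * rayleighCoeff ν n : ℝ) : ℂ) * w ^ n)
      (w * deriv (besselU ν) w) := by
  intro w hw
  simpa only [Complex.ofReal_mul, Complex.ofReal_natCast] using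
    hasSum_mul_deriv_of_hasSum hr0 (hasSum_besselU hν hr) hw

/-! ### The first zero of `φ`. -/

theorem exists_besselPhi_eq_zero : ∃ w, besselPhi ν w = 0 := by
  by_contra! h
  have hν1 : 0 < ν + 1 := by linarith
  have hν2 : 0 < ν + 2 := by linarith
  set ρ := 1 / (4 * (ν + 1) * (ν + 2)) with hρ
  have hρ0 : 0 < ρ := by positivity
  -- Without zeros the series of `U` would converge at `ρ⁻¹`, where its terms stay above `ν + 2`.
  have hs := hasSum_re_of_hasSum (hasSum_besselU hν (r := |ρ⁻¹| + 1) fun w _ => h w) (x := ρ⁻¹)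
    (by linarith)
  have h0 := hs.summable.tendsto_atTop_zero
  have := ge_of_tendsto h0 (b := ν + 2) (by
    filter_upwards [eventually_ge_atTop 1] with n hn
    calc ν + 2 = (ν + 2) * ρ ^ n * ρ⁻¹ ^ n := by
          rw [mul_assoc, ← mul_pow, mul_inv_cancel₀ hρ0.ne', one_pow, mul_one]
      _ ≤ _ := by
          gcongr
          exact rayleighCoeff_ge hν hn)
  linarith

theorem exists_least_norm_zero_besselPhi :
    ∃ w, besselPhi ν w = 0 ∧ 0 < ‖w‖ ∧ ∀ z ∈ ball (0 : ℂ) ‖w‖, besselPhi ν z ≠ 0 := by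
  have hc : IsClosed {w | besselPhi ν w = 0} :=
    isClosed_eq (differentiable_besselPhi hν).continuous continuous_const
  obtain ⟨w, hw, hmin⟩ := hc.exists_infDist_eq_dist (exists_besselPhi_eq_zero hν) 0
  refine ⟨w, hw, ?_, fun z hz hz0 => ?_⟩
  · rw [norm_pos_iff]
    rintro rfl
    simp [besselPhi_zero hν] at hw
  · have h1 : Metric.infDist 0 {w | besselPhi ν w = 0} ≤ dist 0 z := Metric.infDist_le_dist_of_mem hz0
    rw [hmin, dist_zero_left, dist_zero_left] at h1
    rw [mem_ball_zero_iff] at hz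
    linarith

/-- The zero of least modulus is positive (a variant of Pringsheim's theorem). -/
theorem exists_first_zero_besselPhi :
    ∃ R : ℝ, 0 < R ∧ besselPhi ν R = 0 ∧ ∀ z ∈ ball (0 : ℂ) R, besselPhi ν z ≠ 0 := by
  obtain ⟨w, hw, hpos, hball⟩ := exists_least_norm_zero_besselPhi hν
  refine ⟨‖w‖, hpos, ?_, hball⟩
  by_contra hne
  have hφ := differentiable_besselPhi hν
  have hne' : ∀ x ∈ Icc 0 ‖w‖, besselPhi ν (x : ℂ) ≠ 0 := by
    intro x hx
    rcases hx.2.lt_or_eq with h | h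
    · exact hball x (by simpa [abs_of_nonneg hx.1] using h)
    · rwa [h]
  -- If `φ` does not vanish at `‖w‖`, then `U` is bounded on `[0, ‖w‖]`, hence by domination on the
  -- whole disk. The resulting bound `‖z φ'‖ ≤ C ‖φ‖` has no quotient and extends to the boundary
  -- point `w`.
  have hcont : ContinuousOn (fun x : ℝ => besselU ν x) (Icc 0 ‖w‖) := by
    intro x hx
    exact ((differentiableAt_besselU hν (hne' x hx)).continuousAt.comp
      Complex.continuous_ofReal.continuousAt).continuousWithinAt
  obtain ⟨C, hC⟩ := isCompact_Icc.exists_bound_of_continuousOn hcont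
  have hb : ∀ z ∈ ball (0 : ℂ) ‖w‖, ‖z * deriv (besselPhi ν) z‖ ≤ C * ‖besselPhi ν z‖ := by
    intro z hz
    have hz' : ‖z‖ < ‖w‖ := by simpa using hz
    have h1 := norm_le_re_of_hasSum (rayleighCoeff_nonneg hν) (hasSum_besselU hν hball) hz'
    have h2 := (h1.trans (Complex.re_le_norm _)).trans (hC ‖z‖ ⟨norm_nonneg _, hz'.le⟩)
    rwa [besselU, norm_neg, norm_div, div_le_iff₀ (norm_pos_iff.2 (hball z hz))] at h2
  have hb' : ∀ z ∈ closedBall (0 : ℂ) ‖w‖, ‖z * deriv (besselPhi ν) z‖ ≤ C * ‖besselPhi ν z‖ := by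
    intro z hz
    rw [← closure_ball _ hpos.ne'] at hz
    have hd := (differentiable_deriv_besselPhi hν).continuous
    have hc := hφ.continuous
    exact le_on_closure hb (by fun_prop) (by fun_prop) hz
  have hder : ∀ t : ℝ, HasDerivAt (fun t : ℝ => besselPhi ν ((1 - t) * w))
      (-(w * deriv (besselPhi ν) ((1 - t) * w))) t := by
    intro t
    have h1 := HasDerivAt.comp (h₂ := besselPhi ν) (h := fun s : ℂ => (1 - s) * w) (t : ℂ)
      (hφ ((1 - t) * w)).hasDerivAt (((hasDerivAt_id (t : ℂ)).const_sub 1).mul_const w)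
    convert! h1.comp_ofReal using 1
    simp [mul_comm]
  -- Grönwall along the segment from `w` to `w / 2` carries the zero at `w` into the open disk. The
  -- constant is `2 * C` because `1 - t ≥ 1 / 2` there.
  have h0 := eq_zero_of_abs_deriv_le_mul_abs_self_of_eq_zero_right (a := 0) (b := 1 / 2)
    (K := 2 * C) (fun t _ => (hder t).continuousAt.continuousWithinAt)
    (fun t _ => (hder t).hasDerivWithinAt) (by simpa using hw) ?_ (1 / 2) (by norm_num)
  · refine hball _ ?_ h0
    rw [mem_ball_zero_iff, norm_mul]
    norm_num
    linarith
  · intro t ht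
    have hn : ‖(1 - t : ℂ)‖ = 1 - t := by
      rw [show (1 - t : ℂ) = ((1 - t : ℝ) : ℂ) by push_cast; ring, Complex.norm_real,
        Real.norm_of_nonneg (by linarith [ht.2])]
    have h1 := hb' ((1 - t) * w) (by
      rw [mem_closedBall_zero_iff, norm_mul, hn]
      nlinarith [ht.1])
    rw [mul_assoc, norm_mul, hn] at h1
    rw [norm_neg]
    nlinarith [norm_nonneg (w * deriv (besselPhi ν) ((1 - t) * w)), ht.2]

end

/-! ### Bessel functions, the Dini function and the quotients in terms of `φ` and `U`. -/

/-- Division by a positive real leaves the argument unchanged, so the principal branches agree. -/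
theorem div_two_cpow {z : ℂ} (hz : z ≠ 0) (s : ℂ) : (z / 2) ^ s = z ^ s / 2 ^ s := by
  have h := Complex.log_ofReal_mul (r := 1 / 2) (by norm_num) hz
  have h2 : z / 2 = ((1 / 2 : ℝ) : ℂ) * z := by push_cast; ring
  have h3 : ((Real.log (1 / 2) : ℝ) : ℂ) = -Complex.log 2 := by
    rw [one_div, Real.log_inv]; push_cast; simp
  rw [Complex.cpow_def_of_ne_zero (by simpa using hz), Complex.cpow_def_of_ne_zero hz,
    Complex.cpow_def_of_ne_zero two_ne_zero, ← Complex.exp_sub, h2, h, h3]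
  ring_nf

/-- The function `besselU + 2 α w besselU' / (1 - 2 besselU)`, an affine image of the
`α`-convexity quotient of `besselG`. -/
def besselF (ν : ℝ) (α : ℝ) (w : ℂ) : ℂ :=
  besselU ν w + 2 * α * (w * deriv (besselU ν) w / (1 - 2 * besselU ν w))

theorem one_sub_two_mul_besselU {ν : ℝ} {w : ℂ} (hw : besselPhi ν w ≠ 0) :
    besselPhi ν w + 2 * w * deriv (besselPhi ν) w = besselPhi ν w * (1 - 2 * besselU ν w) := by
  rw [besselU]; field_simp; ring

section
variable {ν : ℝ} (hν : -1 < ν)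
include hν

theorem besselJ_eq {z : ℂ} (hz : z ≠ 0) :
    besselJ ν z = (z / 2) ^ (ν : ℂ) / Complex.Gamma (ν + 1) * besselPhi ν (z ^ 2) := by
  have h1 := Gamma_nu_ne_zero hν
  rw [besselJ, besselPhi, ← tsum_mul_left]
  refine tsum_congr fun n => ?_
  have h2 := Gamma_ne_zero_of_natCast_add hν n
  have h3 : (n.factorial : ℂ) ≠ 0 := by exact_mod_cast n.factorial_ne_zero
  rw [Complex.cpow_add _ _ (by simpa using hz),
    show (2 * (n : ℂ)) = ((2 * n : ℕ) : ℂ) by push_cast; ring, Complex.cpow_natCast, besselCoeff,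
    div_pow, pow_mul z, pow_mul 2, show (2 : ℂ) ^ 2 = 4 by norm_num]
  field_simp

theorem besselJ_add_one_eq {z : ℂ} (hz : z ≠ 0) :
    besselJ (ν + 1) z =
      -2 * z * ((z / 2) ^ (ν : ℂ) / Complex.Gamma (ν + 1)) * deriv (besselPhi ν) (z ^ 2) := by
  have h1 := Gamma_nu_ne_zero hν
  have h0 : (ν + 1 : ℂ) ≠ 0 := by simpa using natCast_add_ne_zero hν 0
  have h := besselJ_eq (ν := ν + 1) (by linarith) hz
  push_cast at h
  rw [h, deriv_besselPhi hν, Complex.Gamma_add_one _ h0, Complex.cpow_add _ _ (by simpa using hz),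
    Complex.cpow_one]
  field_simp
  ring

theorem besselJ_add_two_eq {z : ℂ} (hz : z ≠ 0) :
    besselJ (ν + 2) z = 4 * z ^ 2 * ((z / 2) ^ (ν : ℂ) / Complex.Gamma (ν + 1)) *
      deriv (deriv (besselPhi ν)) (z ^ 2) := by
  have h1 := Gamma_nu_ne_zero hν
  have h0 : (ν + 1 : ℂ) ≠ 0 := by simpa using natCast_add_ne_zero hν 0
  have h := besselJ_add_one_eq (ν := ν + 1) (by linarith) hz
  push_cast at h
  rw [show (ν + 2 : ℂ) = ν + 1 + 1 by ring, h, Complex.Gamma_add_one _ h0,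
    Complex.cpow_add _ _ (by simpa using hz), Complex.cpow_one,
    show deriv (besselPhi ν) = fun w => -(1 / (4 * (ν + 1))) * besselPhi (ν + 1) w from
      funext (deriv_besselPhi hν), deriv_const_mul_field]
  field_simp

theorem besselG_eq : besselG ν = fun z => z * besselPhi ν (z ^ 2) := by
  ext z
  rcases eq_or_ne z 0 with rfl | hz
  -- For `ν = 1` the power `0 ^ (1 - ν)` is `1`, and the value `0` comes from `J_1(0) = 0` instead.
  · by_cases h : (1 - ν : ℂ) = 0
    · have hν1 : (ν : ℂ) = 1 := (sub_eq_zero.1 h).symm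
      have : besselJ ν 0 = 0 := by
        rw [besselJ]
        convert tsum_zero with n
        have h2 : (2 * n + ν : ℂ) ≠ 0 := by
          rw [hν1]
          exact_mod_cast (2 * n).succ_ne_zero
        simp [Complex.zero_cpow h2]
      simp [besselG, this]
    · simp [besselG, Complex.zero_cpow h]
  · have h1 := Gamma_nu_ne_zero hν
    have h2 : (2 : ℂ) ^ (ν : ℂ) ≠ 0 := by simp [Complex.cpow_eq_zero_iff]
    have h3 : z ^ (ν : ℂ) ≠ 0 := by simp [Complex.cpow_eq_zero_iff, hz]
    rw [besselG, besselJ_eq hν hz, div_two_cpow hz, Complex.cpow_sub _ _ hz, Complex.cpow_one]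
    field_simp

theorem hasDerivAt_besselG (z : ℂ) :
    HasDerivAt (besselG ν) (besselPhi ν (z ^ 2) + 2 * z ^ 2 * deriv (besselPhi ν) (z ^ 2)) z := by
  rw [besselG_eq hν]
  have h1 := HasDerivAt.comp (h₂ := besselPhi ν) (h := fun s : ℂ => s ^ 2) z
    (differentiable_besselPhi hν _).hasDerivAt (hasDerivAt_pow 2 z)
  convert! (hasDerivAt_id z).mul h1 using 1
  simp
  ring

theorem differentiable_besselG : Differentiable ℂ (besselG ν) :=
  fun z => (hasDerivAt_besselG hν z).differentiableAt

theorem hasDerivAt_deriv_besselG (z : ℂ) :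
    HasDerivAt (deriv (besselG ν)) (6 * z * deriv (besselPhi ν) (z ^ 2) +
      4 * z ^ 3 * deriv (deriv (besselPhi ν)) (z ^ 2)) z := by
  rw [funext fun z => (hasDerivAt_besselG hν z).deriv]
  have h1 := HasDerivAt.comp (h₂ := besselPhi ν) (h := fun s : ℂ => s ^ 2) z
    (differentiable_besselPhi hν _).hasDerivAt (hasDerivAt_pow 2 z)
  have h2 := HasDerivAt.comp (h₂ := deriv (besselPhi ν)) (h := fun s : ℂ => s ^ 2) z
    (differentiable_deriv_besselPhi hν _).hasDerivAt (hasDerivAt_pow 2 z)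
  convert! h1.add (((hasDerivAt_pow 2 z).const_mul 2).mul h2) using 1
  simp
  ring

/-- As `g_ν` is a constant times `z ^ (1 - ν) J_ν`, the Dini function is a nonvanishing multiple of
`g_ν'`. -/
theorem besselDini_eq {x : ℝ} (hx : 0 < x) :
    besselDini ν x = ((x / 2 : ℂ) ^ (ν : ℂ) / Complex.Gamma (ν + 1)) *
      (besselPhi ν (x ^ 2) + 2 * x ^ 2 * deriv (besselPhi ν) (x ^ 2)) := by
  have hx0 : (x : ℂ) ≠ 0 := by exact_mod_cast hx.ne'
  have h1 := Gamma_nu_ne_zero hν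
  have hev : besselJ ν =ᶠ[𝓝 (x : ℂ)]
      fun z => (z / 2) ^ (ν : ℂ) / Complex.Gamma (ν + 1) * besselPhi ν (z ^ 2) := by
    filter_upwards [isOpen_ne.mem_nhds hx0] with z hz using besselJ_eq hν hz
  have h2 := HasDerivAt.comp (h₂ := besselPhi ν) (h := fun s : ℂ => s ^ 2) (x : ℂ)
    (differentiable_besselPhi hν _).hasDerivAt (hasDerivAt_pow 2 (x : ℂ))
  have hslit : (x / 2 : ℂ) ∈ Complex.slitPlane := by
    have : (x / 2 : ℂ) = ((x / 2 : ℝ) : ℂ) := by push_cast; ring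
    rw [this, Complex.ofReal_mem_slitPlane]
    positivity
  have h3 := ((hasDerivAt_id (x : ℂ)).div_const 2).cpow_const (c := ν) hslit
  have h4 := (h3.div_const (Complex.Gamma (ν + 1))).mul h2
  rw [besselDini, besselJ_eq hν hx0, hev.deriv_eq]
  erw [h4.deriv]
  rw [Complex.cpow_sub _ _ (by simpa using hx0), Complex.cpow_one]
  simp only [id, Function.comp_apply]
  field_simp
  ring

theorem besselJ_factor_ne_zero {x : ℝ} (hx : 0 < x) :
    ((x / 2 : ℂ) ^ (ν : ℂ) / Complex.Gamma (ν + 1)) ≠ 0 := by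
  have hx0 : (x : ℂ) ≠ 0 := by exact_mod_cast hx.ne'
  exact div_ne_zero (by simp [Complex.cpow_eq_zero_iff, hx0]) (Gamma_nu_ne_zero hν)

theorem mul_deriv_besselU {w : ℂ} (hw : besselPhi ν w ≠ 0) :
    w * deriv (besselU ν) w = -(w * deriv (besselPhi ν) w) / besselPhi ν w
      - w ^ 2 * deriv (deriv (besselPhi ν)) w / besselPhi ν w
      + w ^ 2 * deriv (besselPhi ν) w ^ 2 / besselPhi ν w ^ 2 := by
  have h1 := (differentiable_besselPhi hν w).hasDerivAt
  have h2 := (differentiable_deriv_besselPhi hν w).hasDerivAt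
  have h3 : HasDerivAt (besselU ν) _ w := (((hasDerivAt_id w).mul h2).div h1 hw).neg
  rw [h3.deriv]
  simp only [id, Pi.mul_apply]
  field_simp
  ring

theorem starlikeQuot_besselG {z : ℂ} (hz : besselPhi ν (z ^ 2) ≠ 0) :
    starlikeQuot (besselG ν) z = 1 - 2 * besselU ν (z ^ 2) := by
  rw [starlikeQuot]
  split_ifs with h
  · simp [h, besselU]
  · rw [(hasDerivAt_besselG hν z).deriv, one_sub_two_mul_besselU hz, besselG_eq hν]
    field_simp

/-- The left side is `w` times the logarithmic derivative of `φ + 2 w φ' = φ (1 - 2 U)`, and the two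
factors contribute `-U` and `-2 w U' / (1 - 2 U)`. -/
theorem besselU_log_deriv {w : ℂ} (hw : besselPhi ν w ≠ 0) (hw' : 1 - 2 * besselU ν w ≠ 0) :
    (3 * w * deriv (besselPhi ν) w + 2 * w ^ 2 * deriv (deriv (besselPhi ν)) w) /
      (besselPhi ν w + 2 * w * deriv (besselPhi ν) w) = -besselF ν 1 w := by
  have hψ := mul_ne_zero hw hw'
  rw [← one_sub_two_mul_besselU hw] at hψ
  have e : 1 - 2 * besselU ν w =
      (besselPhi ν w + 2 * w * deriv (besselPhi ν) w) / besselPhi ν w := by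
    rw [one_sub_two_mul_besselU hw]; field_simp
  rw [besselF, e, mul_deriv_besselU hν hw, besselU]
  generalize hs : besselPhi ν w + 2 * w * deriv (besselPhi ν) w = s at *
  push_cast
  field_simp
  rw [← hs]
  ring

theorem convexQuot_besselG {z : ℂ} (hz : besselPhi ν (z ^ 2) ≠ 0)
    (hz' : 1 - 2 * besselU ν (z ^ 2) ≠ 0) :
    convexQuot (besselG ν) z = 1 - 2 * besselF ν 1 (z ^ 2) := by
  rw [convexQuot, (hasDerivAt_deriv_besselG hν z).deriv, (hasDerivAt_besselG hν z).deriv,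
    sub_eq_add_neg, ← mul_neg, ← besselU_log_deriv hν hz hz']
  ring

/-- The equation for the radius in terms of `besselF`. -/
theorem bessel_equation_lhs {α r : ℝ} (hr : 0 < r) (h1 : besselPhi ν (r ^ 2) ≠ 0)
    (h2 : α ≠ 0 → 1 - 2 * besselU ν (r ^ 2) ≠ 0) :
    1 + ((α : ℂ) - 1) * (r * besselJ (ν + 1) r / besselJ ν r)
      + (α : ℂ) * r * ((r * besselJ (ν + 2) r - 3 * besselJ (ν + 1) r) /
        (besselJ ν r - r * besselJ (ν + 1) r)) = 1 - 2 * besselF ν α (r ^ 2) := by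
  have hr0 : (r : ℂ) ≠ 0 := by exact_mod_cast hr.ne'
  have hc := besselJ_factor_ne_zero hν hr
  rw [besselJ_eq hν hr0, besselJ_add_one_eq hν hr0, besselJ_add_two_eq hν hr0]
  set c := ((r / 2 : ℂ) ^ (ν : ℂ) / Complex.Gamma (ν + 1))
  have e1 : r * (-2 * r * c * deriv (besselPhi ν) (r ^ 2)) / (c * besselPhi ν (r ^ 2)) =
      2 * besselU ν (r ^ 2) := by
    rw [besselU]; field_simp
  -- For `α = 0` the second denominator may vanish, but its coefficient removes the quotient.
  rcases eq_or_ne α 0 with rfl | hα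
  · rw [e1, besselF]; simp; ring
  have h3 := besselU_log_deriv hν h1 (h2 hα)
  have hψ := mul_ne_zero h1 (h2 hα)
  rw [← one_sub_two_mul_besselU h1] at hψ
  have e2 : r * ((r * (4 * r ^ 2 * c * deriv (deriv (besselPhi ν)) (r ^ 2))
      - 3 * (-2 * r * c * deriv (besselPhi ν) (r ^ 2))) /
      (c * besselPhi ν (r ^ 2) - r * (-2 * r * c * deriv (besselPhi ν) (r ^ 2)))) =
      -2 * besselF ν 1 (r ^ 2) := by
    rw [show -2 * besselF ν 1 (r ^ 2) = 2 * -besselF ν 1 (r ^ 2) by ring, ← h3,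
      show c * besselPhi ν (r ^ 2) - r * (-2 * r * c * deriv (besselPhi ν) (r ^ 2)) =
      c * (besselPhi ν (r ^ 2) + 2 * r ^ 2 * deriv (besselPhi ν) (r ^ 2)) by ring]
    field_simp
    ring
  rw [e1, mul_assoc, e2, besselF, besselF]
  push_cast
  ring

end

/-! ### Monotonicity and domination on the positive axis. -/

theorem ofReal_re_besselPhi {ν : ℝ} (hν : -1 < ν) (x : ℝ) :
    ((besselPhi ν x).re : ℂ) = besselPhi ν x := by
  refine ofReal_re_of_hasSum (R := |x| + 1) (t := fun n => (-1) ^ n * Real.Gamma (ν + 1) /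
    (4 ^ n * n.factorial * Real.Gamma (n + ν + 1))) (fun w _ => ?_) (by linarith)
  convert! hasSum_besselPhi hν w using 1
  ext n
  rw [besselCoeff]
  push_cast [← Complex.Gamma_ofReal]
  rfl

/-- The real-valued restriction of `besselU` to the real line. -/
def realU (ν x : ℝ) : ℝ := (besselU ν x).re

/-- The real-valued restriction of `w ↦ w * deriv (besselU ν) w` to the real line. -/
def realD (ν x : ℝ) : ℝ := ((x : ℂ) * deriv (besselU ν) x).re

/-- The real-valued restriction of `besselF` to the real line. -/
def realF (ν α x : ℝ) : ℝ := realU ν x + 2 * α * (realD ν x / (1 - 2 * realU ν x))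

theorem realU_zero (ν : ℝ) : realU ν 0 = 0 := by simp [realU, besselU]

theorem realD_zero (ν : ℝ) : realD ν 0 = 0 := by simp [realD]

section
variable {ν R : ℝ} (hν : -1 < ν) (hball : ∀ w ∈ ball (0 : ℂ) R, besselPhi ν w ≠ 0)
include hν hball

theorem strictMonoOn_realU : StrictMonoOn (realU ν) (Ico 0 R) :=
  strictMonoOn_re_of_hasSum (rayleighCoeff_nonneg hν) (hasSum_besselU hν hball)
    (rayleighCoeff_one_pos hν)

theorem realU_lt_half {a : ℝ} (ha : a ∈ Ioo 0 R) (hUa : realU ν a = 1 / 2) {x : ℝ}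
    (hx : x ∈ Ico 0 a) : realU ν x < 1 / 2 := by
  rw [← hUa]
  exact strictMonoOn_realU hν hball ⟨hx.1, hx.2.trans ha.2⟩ ⟨ha.1.le, ha.2⟩ hx.2

theorem ofReal_realU {x : ℝ} (hx : x ∈ Ico 0 R) : (realU ν x : ℂ) = besselU ν x :=
  ofReal_re_of_hasSum (hasSum_besselU hν hball) (by rw [abs_of_nonneg hx.1]; exact hx.2)

theorem norm_besselU_le {w : ℂ} (hw : ‖w‖ < R) : ‖besselU ν w‖ ≤ realU ν ‖w‖ :=
  norm_le_re_of_hasSum (rayleighCoeff_nonneg hν) (hasSum_besselU hν hball) hw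

theorem one_sub_two_mul_besselU_ne_zero {a : ℝ} (ha : a ∈ Ioo 0 R)
    (hUa : realU ν a = 1 / 2) {w : ℂ} (hw : ‖w‖ < a) : 1 - 2 * besselU ν w ≠ 0 := by
  have h1 := norm_besselU_le hν hball (hw.trans ha.2)
  have h2 := realU_lt_half hν hball ha hUa ⟨norm_nonneg _, hw⟩
  intro h
  have h3 : besselU ν w = 1 / 2 := by linear_combination -h / 2
  rw [h3] at h1
  norm_num at h1
  linarith

end

section
variable {ν R : ℝ} (hν : -1 < ν) (hR : 0 < R) (hball : ∀ w ∈ ball (0 : ℂ) R, besselPhi ν w ≠ 0)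
include hν hR hball

theorem strictMonoOn_realD : StrictMonoOn (realD ν) (Ico 0 R) :=
  strictMonoOn_re_of_hasSum (F := fun w => w * deriv (besselU ν) w)
    (fun n => mul_nonneg n.cast_nonneg (rayleighCoeff_nonneg hν n))
    (hasSum_mul_deriv_besselU hν hR hball) (by simpa using rayleighCoeff_one_pos hν)

theorem ofReal_realD {x : ℝ} (hx : x ∈ Ico 0 R) : (realD ν x : ℂ) = x * deriv (besselU ν) x :=
  ofReal_re_of_hasSum (F := fun w => w * deriv (besselU ν) w)
    (hasSum_mul_deriv_besselU hν hR hball) (by rw [abs_of_nonneg hx.1]; exact hx.2)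

theorem ofReal_realF (α : ℝ) {x : ℝ} (hx : x ∈ Ico 0 R) : (realF ν α x : ℂ) = besselF ν α x := by
  rw [realF, besselF]
  push_cast
  rw [ofReal_realU hν hball hx, ofReal_realD hν hR hball hx]

theorem norm_mul_deriv_besselU_le {w : ℂ} (hw : ‖w‖ < R) :
    ‖w * deriv (besselU ν) w‖ ≤ realD ν ‖w‖ :=
  norm_le_re_of_hasSum (F := fun w => w * deriv (besselU ν) w)
    (fun n => mul_nonneg n.cast_nonneg (rayleighCoeff_nonneg hν n))
    (hasSum_mul_deriv_besselU hν hR hball) hw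

theorem continuousOn_realU : ContinuousOn (realU ν) (Ico 0 R) := by
  have h := (differentiableOn_of_hasSum hR (hasSum_besselU hν hball)).continuousOn
  refine Complex.continuous_re.comp_continuousOn (h.comp Complex.continuous_ofReal.continuousOn ?_)
  intro x hx
  simpa [abs_of_nonneg hx.1] using hx.2

theorem continuousOn_realD : ContinuousOn (realD ν) (Ico 0 R) := by
  have h := (differentiableOn_of_hasSum hR (hasSum_mul_deriv_besselU hν hR hball)).continuousOn
  refine Complex.continuous_re.comp_continuousOn (h.comp Complex.continuous_ofReal.continuousOn ?_)
  intro x hx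
  simpa [abs_of_nonneg hx.1] using hx.2

theorem realD_pos {x : ℝ} (hx : x ∈ Ioo 0 R) : 0 < realD ν x := by
  rw [← realD_zero ν]
  exact strictMonoOn_realD hν hR hball ⟨le_rfl, hR⟩ ⟨hx.1.le, hx.2⟩ hx.1

theorem realD_nonneg {x : ℝ} (hx : x ∈ Ico 0 R) : 0 ≤ realD ν x := by
  rw [← realD_zero ν]
  exact (strictMonoOn_realD hν hR hball).monotoneOn ⟨le_rfl, hR⟩ hx hx.1

/-- The first zero of the Dini function precedes that of the Bessel function. -/
theorem exists_realU_eq_half (hφR : besselPhi ν R = 0) : ∃ x ∈ Ioo 0 R, realU ν x = 1 / 2 := by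
  have hd : ∀ x : ℝ, HasDerivAt (fun x : ℝ => (besselG ν x).re)
      (besselPhi ν (x ^ 2) + 2 * x ^ 2 * deriv (besselPhi ν) (x ^ 2)).re x := fun x =>
    (hasDerivAt_besselG hν x).real_of_complex
  have hs : ((√R : ℝ) : ℂ) ^ 2 = R := by exact_mod_cast Real.sq_sqrt hR.le
  -- Rolle for `g_ν` on `[0, √R]`; at the critical point `φ (1 - 2 U) = 0` with `φ ≠ 0`.
  obtain ⟨c, hc, hc0⟩ := exists_hasDerivAt_eq_zero (Real.sqrt_pos.2 hR)
    (fun x _ => (hd x).continuousAt.continuousWithinAt)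
    (by simp [besselG_eq hν, hs, hφR]) (fun x _ => hd x)
  have hcR : c ^ 2 < R := by
    have := pow_lt_pow_left₀ hc.2 hc.1.le two_ne_zero
    rwa [Real.sq_sqrt hR.le] at this
  have hcc : c ^ 2 ∈ Ico 0 R := ⟨by positivity, hcR⟩
  refine ⟨c ^ 2, ⟨by have := hc.1; positivity, hcR⟩, ?_⟩
  have hne : besselPhi ν ((c ^ 2 : ℝ) : ℂ) ≠ 0 := hball _ (by simpa using hcR)
  have e : ((c : ℂ) ^ 2) = ((c ^ 2 : ℝ) : ℂ) := by push_cast; rfl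
  rw [e, one_sub_two_mul_besselU hne, ← ofReal_realU hν hball hcc,
    ← ofReal_re_besselPhi hν] at hc0
  rw [← ofReal_re_besselPhi hν] at hne
  norm_cast at hc0 hne
  have := (mul_eq_zero.1 hc0).resolve_left hne
  linarith

variable {a : ℝ} (ha : a ∈ Ioo 0 R) (hUa : realU ν a = 1 / 2)
include ha hUa

/-- `U` and `w U'` increase while `1 - 2 U` decreases and stays positive. -/
theorem strictMonoOn_realF {α : ℝ} (hα : 0 ≤ α) : StrictMonoOn (realF ν α) (Ico 0 a) := by
  intro x hx y hy hxy
  have hx' : x ∈ Ico 0 R := ⟨hx.1, hx.2.trans ha.2⟩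
  have hy' : y ∈ Ico 0 R := ⟨hy.1, hy.2.trans ha.2⟩
  have h1 := strictMonoOn_realU hν hball hx' hy' hxy
  have h2 := strictMonoOn_realD hν hR hball hx' hy' hxy
  have h3 := realU_lt_half hν hball ha hUa hy
  have h4 := realD_nonneg hν hR hball hx'
  have h5 : realD ν x / (1 - 2 * realU ν x) ≤ realD ν y / (1 - 2 * realU ν y) :=
    div_le_div₀ (h4.trans h2.le) h2.le (by linarith) (by linarith)
  have := mul_le_mul_of_nonneg_left h5 (show 0 ≤ 2 * α by positivity)
  rw [realF, realF]
  linarith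

theorem realF_lt_realF {α α' x : ℝ} (h : α < α') (hx : x ∈ Ioo 0 a) :
    realF ν α x < realF ν α' x := by
  have h1 := realU_lt_half hν hball ha hUa ⟨hx.1.le, hx.2⟩
  have h2 := realD_pos hν hR hball ⟨hx.1, hx.2.trans ha.2⟩
  have h3 : 0 < realD ν x / (1 - 2 * realU ν x) := div_pos h2 (by linarith)
  rw [realF, realF]
  nlinarith

/-- Numerator and denominator are estimated separately, the latter by `‖1 - 2 U w‖ ≥ 1 - 2 U ‖w‖ >
0`. -/
theorem norm_besselF_le {α : ℝ} (hα : 0 ≤ α) {w : ℂ} (hw : ‖w‖ < a) :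
    ‖besselF ν α w‖ ≤ realF ν α ‖w‖ := by
  have h1 := norm_besselU_le hν hball (hw.trans ha.2)
  have h2 := realU_lt_half hν hball ha hUa ⟨norm_nonneg _, hw⟩
  have h3 := norm_mul_deriv_besselU_le hν hR hball (hw.trans ha.2)
  have h4 : 1 - 2 * realU ν ‖w‖ ≤ ‖1 - 2 * besselU ν w‖ := by
    have := norm_sub_norm_le 1 (2 * besselU ν w)
    rw [norm_one, norm_mul, Complex.norm_ofNat] at this
    linarith
  have h5 : ‖w * deriv (besselU ν) w / (1 - 2 * besselU ν w)‖ ≤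
      realD ν ‖w‖ / (1 - 2 * realU ν ‖w‖) := by
    rw [norm_div]
    exact div_le_div₀ ((norm_nonneg _).trans h3) h3 (by linarith) h4
  refine (norm_add_le _ _).trans (add_le_add h1 ?_)
  rw [norm_mul, norm_mul, Complex.norm_ofNat, Complex.norm_real, Real.norm_of_nonneg hα]
  gcongr

theorem exists_realF_eq {α t : ℝ} (hα : 0 ≤ α) (ht : 0 < t) (ht' : t ≤ 1 / 2) :
    ∃ x, 0 < x ∧ x ≤ a ∧ (α ≠ 0 → x < a) ∧ realF ν α x = t ∧
      ∀ y ∈ Ico 0 x, realF ν α y < t := by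
  have hsub : Icc 0 a ⊆ Ico 0 R := fun x hx => ⟨hx.1, hx.2.trans_lt ha.2⟩
  have hU := (continuousOn_realU hν hR hball).mono hsub
  have hD := (continuousOn_realD hν hR hball).mono hsub
  rcases hα.eq_or_lt with rfl | hα
  · obtain ⟨x, hx, hxt⟩ := intermediate_value_Icc ha.1.le hU
      (show t ∈ Icc _ _ by rw [realU_zero, hUa]; exact ⟨ht.le, ht'⟩)
    have hF : ∀ y, realF ν 0 y = realU ν y := fun y => by simp [realF]
    refine ⟨x, hx.1.lt_of_ne ?_, hx.2, by simp, by rw [hF, hxt], fun y hy => ?_⟩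
    · rintro rfl
      rw [realU_zero] at hxt
      exact ht.ne hxt
    · rw [hF, ← hxt]
      exact strictMonoOn_realU hν hball (hsub ⟨hy.1, hy.2.le.trans hx.2⟩) (hsub hx) hy.2
  -- For `α > 0` the denominator of `F` vanishes at `a`, so the equation `F = t` is first multiplied
  -- by `1 - 2 U`. The result is `-t < 0` at `0` and `2 α` times a positive number at `a`.
  · have hG : ContinuousOn
        (fun x => (realU ν x - t) * (1 - 2 * realU ν x) + 2 * α * realD ν x) (Icc 0 a) := by
      fun_prop
    obtain ⟨x, hx, hx0⟩ := intermediate_value_Ioo ha.1.le hG (show (0 : ℝ) ∈ Ioo _ _ by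
      simp only [realU_zero, realD_zero, hUa]
      have := mul_pos hα (realD_pos hν hR hball ha)
      constructor <;> linarith)
    have h1 := realU_lt_half hν hball ha hUa ⟨hx.1.le, hx.2⟩
    have hxt : realF ν α x = t := by
      have h2 : 1 - 2 * realU ν x ≠ 0 := by linarith
      rw [realF, ← mul_div_assoc, ← eq_sub_iff_add_eq', div_eq_iff h2]
      linear_combination hx0
    refine ⟨x, hx.1, hx.2.le, fun _ => hx.2, hxt, fun y hy => ?_⟩
    rw [← hxt]
    exact strictMonoOn_realF hν hR hball ha hUa hα.le ⟨hy.1, hy.2.trans hx.2⟩ ⟨hx.1.le, hx.2⟩ hy.2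

end

/-! ### The radii, the equation and the first zeros. -/

/-- A larger disk would contain the real point `q`, where the real part is exactly `β`. The
condition `P q` may fail, which only excludes larger disks sooner. -/
theorem sSup_radius_eq {f Q : ℂ → ℂ} {P : ℂ → Prop} {β q : ℝ} (hf : Differentiable ℂ f)
    (hq : 0 < q) (hlt : ∀ z : ℂ, ‖z‖ < q → P z ∧ β < (Q z).re) (heq : P q → (Q q).re = β) :
    sSup {r : ℝ | 0 < r ∧ DifferentiableOn ℂ f (ball 0 r) ∧
      ∀ z ∈ ball (0 : ℂ) r, P z ∧ β < (Q z).re} = q := by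
  refine IsGreatest.csSup_eq ⟨⟨hq, hf.differentiableOn, fun z hz => hlt z (by simpa using hz)⟩, ?_⟩
  rintro r ⟨hr, -, h⟩
  by_contra! hqr
  obtain ⟨h1, h2⟩ := h q (by simpa [abs_of_pos hq] using hqr)
  exact h2.ne' (heq h1)

section
variable {ν : ℝ} (hν : -1 < ν)
include hν

theorem alphaQuot_besselG {α : ℝ} {z : ℂ} (hz : besselPhi ν (z ^ 2) ≠ 0)
    (hz' : α ≠ 0 → 1 - 2 * besselU ν (z ^ 2) ≠ 0) :
    (1 - (α : ℂ)) * starlikeQuot (besselG ν) z + (α : ℂ) * convexQuot (besselG ν) z =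
      1 - 2 * besselF ν α (z ^ 2) := by
  rw [starlikeQuot_besselG hν hz]
  rcases eq_or_ne α 0 with rfl | hα
  · simp [besselF]
  · rw [convexQuot_besselG hν hz (hz' hα), besselF, besselF]
    push_cast
    ring

theorem deriv_besselG_ne_zero {z : ℂ} (hz : besselPhi ν (z ^ 2) ≠ 0)
    (hz' : 1 - 2 * besselU ν (z ^ 2) ≠ 0) : deriv (besselG ν) z ≠ 0 := by
  rw [(hasDerivAt_besselG hν z).deriv, one_sub_two_mul_besselU hz]
  exact mul_ne_zero hz hz'

variable {R : ℝ} (hR : 0 < R) (hball : ∀ w ∈ ball (0 : ℂ) R, besselPhi ν w ≠ 0) {a : ℝ}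
  (ha : a ∈ Ioo 0 R) (hUa : realU ν a = 1 / 2)
include hR hball ha hUa

/-- The radius is the square root of the point where `realF ν α` reaches `(1 - β) / 2`. -/
theorem exists_radius_eq_sqrt {α β : ℝ} (hα : 0 ≤ α) (hβ : 0 ≤ β) (hβ' : β < 1) :
    ∃ x, 0 < x ∧ x ≤ a ∧ (α ≠ 0 → x < a) ∧ realF ν α x = (1 - β) / 2 ∧
      (∀ y ∈ Ico 0 x, realF ν α y < (1 - β) / 2) ∧
      radiusAlphaConvex α β (besselG ν) = √x ∧
      (α = 0 → radiusStarlike β (besselG ν) = √x) ∧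
      (α = 1 → radiusConvex β (besselG ν) = √x) := by
  obtain ⟨x, hx0, hxa, hxa', hFx, hlt⟩ := exists_realF_eq hν hR hball ha hUa hα
    (t := (1 - β) / 2) (by linarith) (by linarith)
  have hxR : x ∈ Ico 0 R := ⟨hx0.le, hxa.trans_lt ha.2⟩
  have hsx : ((√x : ℝ) : ℂ) ^ 2 = x := by exact_mod_cast Real.sq_sqrt hx0.le
  have hsq : ∀ z : ℂ, ‖z‖ < √x → ‖z ^ 2‖ < x := by
    intro z hz
    rw [norm_pow]
    exact (Real.lt_sqrt (norm_nonneg _)).1 hz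
  have hphi : ∀ z : ℂ, ‖z‖ < √x → besselPhi ν (z ^ 2) ≠ 0 := fun z hz =>
    hball _ (by simpa using (hsq z hz).trans hxR.2)
  have hU : ∀ z : ℂ, ‖z‖ < √x → 1 - 2 * besselU ν (z ^ 2) ≠ 0 := fun z hz =>
    one_sub_two_mul_besselU_ne_zero hν hball ha hUa ((hsq z hz).trans_le hxa)
  have hG : ∀ z : ℂ, ‖z‖ < √x → (z ≠ 0 → besselG ν z ≠ 0) := by
    intro z hz hz0
    rw [besselG_eq hν]
    exact mul_ne_zero hz0 (hphi z hz)
  have hG' : ∀ z : ℂ, ‖z‖ < √x → deriv (besselG ν) z ≠ 0 := fun z hz =>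
    deriv_besselG_ne_zero hν (hphi z hz) (hU z hz)
  have hre : ∀ z : ℂ, ‖z‖ < √x → β < (1 - 2 * besselF ν α (z ^ 2)).re := by
    intro z hz
    have h1 := norm_besselF_le hν hR hball ha hUa hα ((hsq z hz).trans_le hxa)
    have h2 := hlt _ ⟨norm_nonneg _, hsq z hz⟩
    have h3 := Complex.re_le_norm (besselF ν α (z ^ 2))
    have h4 : (1 - 2 * besselF ν α (z ^ 2)).re = 1 - 2 * (besselF ν α (z ^ 2)).re := by simp
    rw [h4]
    linarith
  have hend : (1 - 2 * besselF ν α (((√x : ℝ) : ℂ) ^ 2)).re = β := by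
    rw [hsx, ← ofReal_realF hν hR hball α hxR, hFx]
    norm_cast
    ring
  have hphi' : besselPhi ν (((√x : ℝ) : ℂ) ^ 2) ≠ 0 := by
    rw [hsx]
    exact hball _ (by simpa [abs_of_pos hx0] using hxR.2)
  -- For `α = 0` the point `x` may equal `a`, where `1 - 2 U` vanishes.
  have hU' : α ≠ 0 → 1 - 2 * besselU ν (((√x : ℝ) : ℂ) ^ 2) ≠ 0 := by
    intro h
    rw [hsx]
    refine one_sub_two_mul_besselU_ne_zero hν hball ha hUa ?_
    simpa [abs_of_pos hx0] using hxa' h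
  have hdiff := differentiable_besselG hν
  have hpos := Real.sqrt_pos.2 hx0
  have hF0 : ∀ w, besselF ν 0 w = besselU ν w := fun w => by simp [besselF]
  refine ⟨x, hx0, hxa, hxa', hFx, hlt, ?_, ?_, ?_⟩
  · rw [radiusAlphaConvex]
    simp only [← and_assoc (a := _ → _)]
    refine sSup_radius_eq hdiff hpos (fun z hz => ⟨⟨hG z hz, hG' z hz⟩, ?_⟩) fun _ => ?_
    · rw [alphaQuot_besselG hν (hphi z hz) fun _ => hU z hz]
      exact hre z hz
    · rw [alphaQuot_besselG hν hphi' hU']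
      exact hend
  · rintro rfl
    refine sSup_radius_eq hdiff hpos (fun z hz => ⟨hG z hz, ?_⟩) fun _ => ?_
    · rw [starlikeQuot_besselG hν (hphi z hz), ← hF0]
      simpa using hre z hz
    · rw [starlikeQuot_besselG hν hphi', ← hF0]
      simpa using hend
  · rintro rfl
    refine sSup_radius_eq hdiff hpos (fun z hz => ⟨hG' z hz, ?_⟩) fun _ => ?_
    · rw [convexQuot_besselG hν (hphi z hz) (hU z hz)]
      simpa using hre z hz
    · rw [convexQuot_besselG hν hphi' (hU' one_ne_zero)]
      simpa using hend

theorem isLeast_isPosRootAlphaConvex {α β : ℝ} (hα : 0 ≤ α) (hβ : 0 ≤ β) (hβ' : β < 1) :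
    IsLeast {r : ℝ | IsPosRootAlphaConvex ν α β r} (radiusAlphaConvex α β (besselG ν)) := by
  obtain ⟨x, hx0, hxa, hxa', hFx, hlt, hrad, -⟩ :=
    exists_radius_eq_sqrt hν hR hball ha hUa hα hβ hβ'
  have hxR : x ∈ Ico 0 R := ⟨hx0.le, hxa.trans_lt ha.2⟩
  rw [hrad]
  have hpos := Real.sqrt_pos.2 hx0
  have hpos' : ((√x : ℝ) : ℂ) ≠ 0 := by exact_mod_cast hpos.ne'
  have hsx : ((√x : ℝ) : ℂ) ^ 2 = x := by exact_mod_cast Real.sq_sqrt hx0.le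
  have hphi : besselPhi ν (((√x : ℝ) : ℂ) ^ 2) ≠ 0 := by
    rw [hsx]
    exact hball _ (by simpa [abs_of_pos hx0] using hxR.2)
  have hU : α ≠ 0 → 1 - 2 * besselU ν (((√x : ℝ) : ℂ) ^ 2) ≠ 0 := by
    intro h
    rw [hsx]
    refine one_sub_two_mul_besselU_ne_zero hν hball ha hUa ?_
    simpa [abs_of_pos hx0] using hxa' h
  have hc := besselJ_factor_ne_zero hν hpos
  refine ⟨⟨hpos, fun _ => ?_, fun h => ?_, ?_⟩, ?_⟩
  · rw [besselJ_eq hν hpos']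
    exact mul_ne_zero hc hphi
  · have h1 := mul_ne_zero hc (mul_ne_zero hphi (hU h))
    rw [← one_sub_two_mul_besselU hphi] at h1
    rw [besselJ_eq hν hpos', besselJ_add_one_eq hν hpos']
    convert h1 using 1
    ring
  · rw [bessel_equation_lhs hν hpos hphi hU, hsx, ← ofReal_realF hν hR hball α hxR, hFx]
    push_cast
    ring
  -- A smaller root would give `F (r ^ 2) = (1 - β) / 2` before the first point where this value is
  -- attained.
  · rintro r ⟨hr, -, -, heq⟩
    by_contra! hrx
    have hr2 : r ^ 2 < x := (Real.lt_sqrt hr.le).1 hrx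
    have hrI : r ^ 2 ∈ Ico 0 x := ⟨by positivity, hr2⟩
    have hrR : r ^ 2 ∈ Ico 0 R := ⟨by positivity, hr2.trans hxR.2⟩
    rw [bessel_equation_lhs hν hr (hball _ (by simpa using hrR.2)) fun _ =>
        one_sub_two_mul_besselU_ne_zero hν hball ha hUa (by simpa using hr2.trans_le hxa),
      show (r : ℂ) ^ 2 = ((r ^ 2 : ℝ) : ℂ) by push_cast; rfl,
      ← ofReal_realF hν hR hball α hrR] at heq
    norm_cast at heq
    linarith [hlt _ hrI]

theorem strictAntiOn_radiusAlphaConvex {β : ℝ} (hβ : 0 ≤ β) (hβ' : β < 1) :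
    StrictAntiOn (fun α : ℝ => radiusAlphaConvex α β (besselG ν)) (Ici 0) := by
  intro α hα α' hα' hlt
  obtain ⟨x, hx0, -, -, hFx, -, hrad, -⟩ := exists_radius_eq_sqrt hν hR hball ha hUa hα hβ hβ'
  obtain ⟨x', hx0', -, hxa', hFx', -, hrad', -⟩ :=
    exists_radius_eq_sqrt hν hR hball ha hUa hα' hβ hβ'
  simp only [hrad, hrad']
  refine Real.sqrt_lt_sqrt hx0'.le ?_
  -- If `x ≤ x'`, then `F_α(x) < F_α'(x) ≤ F_α'(x')`, although both ends equal `(1 - β) / 2`.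
  by_contra! hle
  have hxa := hxa' ((mem_Ici.1 hα).trans_lt hlt).ne'
  have h1 := (strictMonoOn_realF hν hR hball ha hUa hα').monotoneOn ⟨hx0.le, hle.trans_lt hxa⟩
    ⟨hx0'.le, hxa⟩ hle
  have h2 := realF_lt_realF hν hR hball ha hUa hlt ⟨hx0, hle.trans_lt hxa⟩
  linarith

end

theorem isLeast_besselDini_zero {ν R a : ℝ} (hν : -1 < ν)
    (hball : ∀ w ∈ ball (0 : ℂ) R, besselPhi ν w ≠ 0) (ha : a ∈ Ioo 0 R)
    (hUa : realU ν a = 1 / 2) : IsLeast {x : ℝ | 0 < x ∧ besselDini ν x = 0} (√a) := by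
  have hpos := Real.sqrt_pos.2 ha.1
  have hsa : ((√a : ℝ) : ℂ) ^ 2 = a := by exact_mod_cast Real.sq_sqrt ha.1.le
  refine ⟨⟨hpos, ?_⟩, ?_⟩
  · rw [besselDini_eq hν hpos, hsa, one_sub_two_mul_besselU
      (hball _ (by simpa [abs_of_pos ha.1] using ha.2)),
      ← ofReal_realU hν hball ⟨ha.1.le, ha.2⟩, hUa]
    norm_num
  · rintro x ⟨hx, hx0⟩
    by_contra! hxa
    have hx2 : x ^ 2 < a := (Real.lt_sqrt hx.le).1 hxa
    have hphi : besselPhi ν ((x : ℂ) ^ 2) ≠ 0 := hball _ (by simpa using hx2.trans ha.2)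
    rw [besselDini_eq hν hx, one_sub_two_mul_besselU hphi] at hx0
    exact mul_ne_zero (besselJ_factor_ne_zero hν hx) (mul_ne_zero hphi
      (one_sub_two_mul_besselU_ne_zero hν hball ha hUa (by simpa using hx2))) hx0

theorem isLeast_besselJ_zero {ν R : ℝ} (hν : -1 < ν) (hR : 0 < R) (hφR : besselPhi ν R = 0)
    (hball : ∀ w ∈ ball (0 : ℂ) R, besselPhi ν w ≠ 0) :
    IsLeast {x : ℝ | 0 < x ∧ besselJ ν x = 0} (√R) := by
  have hpos := Real.sqrt_pos.2 hR
  have hsR : ((√R : ℝ) : ℂ) ^ 2 = R := by exact_mod_cast Real.sq_sqrt hR.le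
  refine ⟨⟨hpos, ?_⟩, ?_⟩
  · rw [besselJ_eq hν (by exact_mod_cast hpos.ne'), hsR, hφR, mul_zero]
  · rintro x ⟨hx, hx0⟩
    by_contra! hxR
    have hx2 : x ^ 2 < R := (Real.lt_sqrt hx.le).1 hxR
    rw [besselJ_eq hν (by exact_mod_cast hx.ne')] at hx0
    exact mul_ne_zero (besselJ_factor_ne_zero hν hx) (hball _ (by simpa using hx2)) hx0

end

theorem theorem2 (ν : ℝ) (hν : -1 < ν) :
    -- the radius is the smallest positive root of the equation
    (∀ α β : ℝ, 0 ≤ α → 0 ≤ β → β < 1 →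
      IsLeast {r : ℝ | IsPosRootAlphaConvex ν α β r} (radiusAlphaConvex α β (besselG ν))) ∧
    -- the bound by the first positive zero of the Dini function
    (∃ a j : ℝ, IsLeast {x : ℝ | 0 < x ∧ besselDini ν x = 0} a ∧
      IsLeast {x : ℝ | 0 < x ∧ besselJ ν x = 0} j ∧ a < j ∧
      ∀ α β : ℝ, 0 ≤ α → 0 ≤ β → β < 1 → radiusAlphaConvex α β (besselG ν) ≤ a) ∧
    -- strict monotonicity in the parameter of convexity
    (∀ β : ℝ, 0 ≤ β → β < 1 →
      StrictAntiOn (fun α : ℝ => radiusAlphaConvex α β (besselG ν)) (Ici 0)) ∧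
    -- strictly between the radii of convexity and starlikeness
    (∀ α β : ℝ, 0 < α → α < 1 → 0 ≤ β → β < 1 →
      radiusConvex β (besselG ν) < radiusAlphaConvex α β (besselG ν) ∧
      radiusAlphaConvex α β (besselG ν) < radiusStarlike β (besselG ν)) := by
  obtain ⟨R, hR, hφR, hball⟩ := exists_first_zero_besselPhi hν
  obtain ⟨a, ha, hUa⟩ := exists_realU_eq_half hν hR hball hφR
  have hanti := fun β hβ hβ' => strictAntiOn_radiusAlphaConvex hν hR hball ha hUa (β := β) hβ hβ'
  refine ⟨fun α β hα hβ hβ' => isLeast_isPosRootAlphaConvex hν hR hball ha hUa hα hβ hβ',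
    ⟨√a, √R, isLeast_besselDini_zero hν hball ha hUa, isLeast_besselJ_zero hν hR hφR hball,
      Real.sqrt_lt_sqrt ha.1.le ha.2, fun α β hα hβ hβ' => ?_⟩, hanti,
    fun α β hα hα' hβ hβ' => ⟨?_, ?_⟩⟩
  · obtain ⟨x, -, hxa, -, -, -, hrad, -⟩ := exists_radius_eq_sqrt hν hR hball ha hUa hα hβ hβ'
    rw [hrad]
    exact Real.sqrt_le_sqrt hxa
  · obtain ⟨x, -, -, -, -, -, hrad, -, hc⟩ :=
      exists_radius_eq_sqrt hν hR hball ha hUa zero_le_one hβ hβ'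
    rw [hc rfl, ← hrad]
    exact hanti β hβ hβ' (mem_Ici.2 hα.le) (mem_Ici.2 zero_le_one) hα'
  · obtain ⟨x, -, -, -, -, -, hrad, hs, -⟩ :=
      exists_radius_eq_sqrt hν hR hball ha hUa le_rfl hβ hβ'
    rw [hs rfl, ← hrad]
    exact hanti β hβ hβ' (mem_Ici.2 le_rfl) (mem_Ici.2 hα.le) hα
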